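/- Let $N,d,m\ge 1$ be integers, $A=(A_1,\dots,A_N)$ with $A_j\in\mathcal M_d(\mathbb C)$, $B\in\mathcal M_{d,m}(\mathbb C)$, $\Lambda=(\Lambda_1,\dots,\Lambda_N)\in(0,+\infty)^N$, $T>0$ and $k\in\mathbb N=\{0,1,2,\dots\}$. Put $\Lambda_{\max}=\max_j\Lambda_j$. For $S>0$, $x_0:[-\Lambda_{\max},0)\to\mathbb C^d$ and $u:[0,S]\to\mathbb C^m$, the solution with initial condition $x_0$ and control $u$ is the unique $x:[-\Lambda_{\max},S]\to\mathbb C^d$ such that $x(t)=\sum_{j=1}^N A_jx(t-\Lambda_j)+Bu(t)$ for all $t\in[0,S]$ and $x(t)=x_0(t)$ for all $t\in[-\Lambda_{\max},0)$. The function $x_0$ is called $\mathcal C^k$-admissible if $x_0\in\mathcal C^k([-\Lambda_{\max},0),\mathbb C^d)$ and, for every $r\in\{0,\dots,k\}$, the limit $\lim_{t\to0^-}x_0^{(r)}(t)$ exists and $\lim_{t\to0^-}x_0^{(r)}(t)-\sum_{j=1}^N A_jx_0^{(r)}(-\Lambda_j)\in\operatorname{Ran}B$. For $\mathbf n\in\mathbb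 Z^N$ define $\Xi_{\mathbf n}\in\mathcal M_d(\mathbb C)$ recursively by $\Xi_{\mathbf n}=0$ if $\mathbf n\notin\mathbb N^N$, $\Xi_0=\mathrm{Id}_d$, and $\Xi_{\mathbf n}=\sum_{k'=1}^N A_{k'}\Xi_{\mathbf n-e_{k'}}$ if $\mathbf n\in\mathbb N^N\setminus\{0\}$. Let $\mathcal N_\Lambda$ be the set of classes $[\mathbf n]$ of $\mathbb N^N$ under the equivalence relation $\mathbf n\sim\mathbf n'\iff\Lambda\cdot\mathbf n=\Lambda\cdot\mathbf n'$, and let $\widehat\Xi^\Lambda_{[\mathbf n]}=\sum_{\mathbf n'\in[\mathbf n]}\Xi_{\mathbf n'}$. Then the following assertions are equivalent. 1. $\operatorname{Span}\{\widehat\Xi^\Lambda_{[\mathbf n]}Bw : [\mathbf n]\in\mathcal N_\Lambda,\ \Lambda\cdot\mathbf n<T,\ w\in\mathbb C^m\}=\mathbb C^d$. 2. For every $\mathcal C^k$-admissible $x_0$ and every $x_1\in\mathbb C^d$ there exists $u\in\mathcal C^k([0,T],\mathbb C^m)$ such that the solution $x$ with initial condition $x_0$ and control $u$ satisfies $x\in\mathcal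 C^k([-\Lambda_{\max},T],\mathbb C^d)$ and $x(T)=x_1$. 3. There exists $\varepsilon_0>0$ such that, for every $\varepsilon\in(0,\varepsilon_0)$, every $\mathcal C^k$-admissible $x_0$ and every $x_1\in\mathcal C^k([0,\varepsilon],\mathbb C^d)$, there exists $u\in\mathcal C^k([0,T+\varepsilon],\mathbb C^m)$ such that the solution $x$ with initial condition $x_0$ and control $u$ satisfies $x\in\mathcal C^k([-\Lambda_{\max},T+\varepsilon],\mathbb C^d)$ and $x(T+t)=x_1(t)$ for all $t\in[0,\varepsilon]$. -/

import Mathlib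

open scoped Matrix Topology

namespace DelaySystem

/-- The largest delay `Λ_max` (a maximum, as it is only used for `N ≥ 1`). -/
noncomputable def maxDelay {N : ℕ} (Λ : Fin N → ℝ) : ℝ := ⨆ j, Λ j

/-- The matrices `Ξ_n`, `n ∈ ℤ^N`: zero outside `ℕ^N`, the identity at `n = 0`, and
`Ξ_n = ∑ k, A_k Ξ_{n - e_k}` on the other elements of `ℕ^N`. -/
noncomputable def Xi {N d : ℕ} (A : Fin N → Matrix (Fin d) (Fin d) ℂ) (n : Fin N → ℤ) :
    Matrix (Fin d) (Fin d) ℂ :=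
  if _h : ∀ i, 0 ≤ n i then
    if n = 0 then 1 else ∑ k, A k * Xi A (n - Pi.single k 1)
  else 0
termination_by ∑ i, (n i + 1).toNat
decreasing_by
  apply Finset.sum_lt_sum
  · intro i _
    by_cases hik : i = k
    · subst hik
      simp
    · simp [hik]
  · refine ⟨k, Finset.mem_univ _, ?_⟩
    have := _h k
    simp
    omega

theorem Xi_of_neg {N d : ℕ} (A : Fin N → Matrix (Fin d) (Fin d) ℂ) {n : Fin N → ℤ}
    (h : ¬ ∀ i, 0 ≤ n i) : Xi A n = 0 := by
  rw [Xi, dif_neg h]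

theorem Xi_zero {N d : ℕ} (A : Fin N → Matrix (Fin d) (Fin d) ℂ) : Xi A 0 = 1 := by
  rw [Xi]
  simp

theorem Xi_rec {N d : ℕ} (A : Fin N → Matrix (Fin d) (Fin d) ℂ) {n : Fin N → ℤ}
    (h : ∀ i, 0 ≤ n i) (h0 : n ≠ 0) : Xi A n = ∑ k, A k * Xi A (n - Pi.single k 1) := by
  rw [Xi, dif_pos h, if_neg h0]

/-- `Λ · n` for `n ∈ ℕ^N`. -/
noncomputable def delayDot {N : ℕ} (Λ : Fin N → ℝ) (n : Fin N → ℕ) : ℝ := ∑ j, Λ j * (n j : ℝ)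

/-- The equivalence relation `n ∼ n'` iff `Λ · n = Λ · n'` on `ℕ^N`. -/
noncomputable def delaySetoid {N : ℕ} (Λ : Fin N → ℝ) : Setoid (Fin N → ℕ) := Setoid.ker (delayDot Λ)

/-- The set of equivalence classes `𝒩_Λ = ℕ^N / ∼`. -/
def DelayClass {N : ℕ} (Λ : Fin N → ℝ) : Type := Quotient (delaySetoid Λ)

/-- The class `[n]_Λ`. -/
noncomputable def delayClass {N : ℕ} (Λ : Fin N → ℝ) (n : Fin N → ℕ) : DelayClass Λ :=
  Quotient.mk (delaySetoid Λ) n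

/-- The common value `Λ · n` of the elements `n` of a class. -/
noncomputable def DelayClass.value {N : ℕ} {Λ : Fin N → ℝ} (c : DelayClass Λ) : ℝ :=
  Setoid.kerLift (delayDot Λ) c

/-- `Ξ̂^Λ_{[n]} = ∑_{n' ∈ [n]} Ξ_{n'}`. The sum is over a finite set when the delays are positive,
see `finite_class`. -/
noncomputable def XiHat {N d : ℕ} (A : Fin N → Matrix (Fin d) (Fin d) ℂ) {Λ : Fin N → ℝ}
    (c : DelayClass Λ) : Matrix (Fin d) (Fin d) ℂ :=
  ∑ᶠ (n : Fin N → ℕ) (_ : delayClass Λ n = c), Xi A (fun j => (n j : ℤ))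

theorem delayClass_value {N : ℕ} (Λ : Fin N → ℝ) (n : Fin N → ℕ) :
    (delayClass Λ n).value = ∑ j, Λ j * (n j : ℝ) := rfl

theorem finite_class {N : ℕ} {Λ : Fin N → ℝ} (hΛ : ∀ j, 0 < Λ j) (c : DelayClass Λ) :
    {n : Fin N → ℕ | delayClass Λ n = c}.Finite := by
  refine (Set.finite_Iic (fun j => ⌊c.value / Λ j⌋₊)).subset ?_
  rintro n rfl j
  refine Nat.le_floor ?_
  rw [le_div_iff₀ (hΛ j), delayClass_value, mul_comm]
  exact Finset.single_le_sum (f := fun j => Λ j * (n j : ℝ))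
    (fun i _ => mul_nonneg (hΛ i).le (Nat.cast_nonneg _)) (Finset.mem_univ j)

/-- `x` is a solution on `[-Λ_max, T]` of `x(t) = ∑ j, A_j x(t - Λ_j) + B u(t)` with initial
condition `x₀` and control `u`. Only the values of `x₀` on `[-Λ_max, 0)`, of `u` on `[0, T]`
and of `x` on `[-Λ_max, T]` matter. -/
structure IsSolution {N d m : ℕ} (A : Fin N → Matrix (Fin d) (Fin d) ℂ)
    (B : Matrix (Fin d) (Fin m) ℂ) (Λ : Fin N → ℝ) (T : ℝ)
    (x₀ : ℝ → Fin d → ℂ) (u : ℝ → Fin m → ℂ) (x : ℝ → Fin d → ℂ) : Prop where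
  eqn : ∀ t ∈ Set.Icc 0 T, x t = ∑ j, A j *ᵥ x (t - Λ j) + B *ᵥ u t
  init : ∀ t ∈ Set.Ico (-maxDelay Λ) 0, x t = x₀ t

/-- Solutions are unique on `[-Λ_max, T]`, so that one may speak of the solution. -/
theorem IsSolution.eqOn {N d m : ℕ} {A : Fin N → Matrix (Fin d) (Fin d) ℂ}
    {B : Matrix (Fin d) (Fin m) ℂ} {Λ : Fin N → ℝ} (hΛ : ∀ j, 0 < Λ j) {T : ℝ}
    {x₀ : ℝ → Fin d → ℂ} {u : ℝ → Fin m → ℂ} {x y : ℝ → Fin d → ℂ}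
    (hx : IsSolution A B Λ T x₀ u x) (hy : IsSolution A B Λ T x₀ u y) :
    Set.EqOn x y (Set.Icc (-maxDelay Λ) T) := by
  obtain ⟨δ, hδ, hδΛ⟩ : ∃ δ : ℝ, 0 < δ ∧ ∀ j, δ ≤ Λ j := by
    rcases isEmpty_or_nonempty (Fin N) with h | h
    · exact ⟨1, one_pos, fun j => h.elim j⟩
    · obtain ⟨i, hi⟩ := Finite.exists_min Λ
      exact ⟨Λ i, hΛ i, hi⟩
  have key : ∀ n : ℕ, ∀ t ∈ Set.Icc (-maxDelay Λ) T, t < n * δ → x t = y t := by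
    intro n
    induction n with
    | zero =>
      intro t ht h
      have h0 : t < 0 := by simpa using h
      rw [hx.init t ⟨ht.1, h0⟩, hy.init t ⟨ht.1, h0⟩]
    | succ n ih =>
      intro t ht h
      rcases lt_or_ge t 0 with h0 | h0
      · rw [hx.init t ⟨ht.1, h0⟩, hy.init t ⟨ht.1, h0⟩]
      · rw [hx.eqn t ⟨h0, ht.2⟩, hy.eqn t ⟨h0, ht.2⟩]
        congr 1
        refine Finset.sum_congr rfl fun j _ => ?_
        have hj : Λ j ≤ maxDelay Λ := le_ciSup (Set.finite_range Λ).bddAbove j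
        rw [ih (t - Λ j) ⟨by linarith, by linarith [hΛ j, ht.2]⟩]
        push_cast at h
        linarith [hδΛ j]
  intro t ht
  obtain ⟨n, hn⟩ := exists_nat_gt (t / δ)
  exact key n t ht ((div_lt_iff₀ hδ).1 hn)

/-- `x₀` is `C^k`-admissible: it is `C^k` on `[-Λ_max, 0)` and, for every `r ≤ k`, the limit of
`x₀^{(r)}(t)` as `t → 0⁻` exists and
`lim_{t → 0⁻} x₀^{(r)}(t) - ∑ j, A_j x₀^{(r)}(-Λ_j)` is in the range of `B`.
Derivatives are taken in `[-Λ_max, 0)`, hence from the right at `-Λ_max`. -/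
structure IsAdmissible {N d m : ℕ} (A : Fin N → Matrix (Fin d) (Fin d) ℂ)
    (B : Matrix (Fin d) (Fin m) ℂ) (Λ : Fin N → ℝ) (k : ℕ) (x₀ : ℝ → Fin d → ℂ) : Prop where
  contDiffOn : ContDiffOn ℝ k x₀ (Set.Ico (-maxDelay Λ) 0)
  compat : ∀ r ≤ k, ∃ l : Fin d → ℂ,
    Filter.Tendsto (iteratedDerivWithin r x₀ (Set.Ico (-maxDelay Λ) 0)) (𝓝[<] 0) (𝓝 l) ∧
    l - ∑ j, A j *ᵥ iteratedDerivWithin r x₀ (Set.Ico (-maxDelay Λ) 0) (-Λ j) ∈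
      LinearMap.range B.mulVecLin

/-- The span condition with strict inequality. -/
def SpanCondition {N d m : ℕ} (A : Fin N → Matrix (Fin d) (Fin d) ℂ)
    (B : Matrix (Fin d) (Fin m) ℂ) (Λ : Fin N → ℝ) (T : ℝ) : Prop :=
  Submodule.span ℂ {v : Fin d → ℂ | ∃ (c : DelayClass Λ) (w : Fin m → ℂ),
    c.value < T ∧ v = (XiHat A c * B) *ᵥ w} = ⊤

/-- Every `C^k`-admissible initial condition can be steered to every final state at time `T`,
with a `C^k` control and a `C^k` solution. -/
def CkControllable {N d m : ℕ} (A : Fin N → Matrix (Fin d) (Fin d) ℂ)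
    (B : Matrix (Fin d) (Fin m) ℂ) (Λ : Fin N → ℝ) (T : ℝ) (k : ℕ) : Prop :=
  ∀ x₀ : ℝ → Fin d → ℂ, IsAdmissible A B Λ k x₀ → ∀ x₁ : Fin d → ℂ,
    ∃ u : ℝ → Fin m → ℂ, ContDiffOn ℝ k u (Set.Icc 0 T) ∧
      ∃ x : ℝ → Fin d → ℂ, IsSolution A B Λ T x₀ u x ∧
        ContDiffOn ℝ k x (Set.Icc (-maxDelay Λ) T) ∧ x T = x₁

/-- For small `ε > 0`, from every `C^k`-admissible initial condition every `C^k` target on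
`[T, T + ε]` can be tracked, with a `C^k` control and a `C^k` solution. -/
def CkTrackable {N d m : ℕ} (A : Fin N → Matrix (Fin d) (Fin d) ℂ)
    (B : Matrix (Fin d) (Fin m) ℂ) (Λ : Fin N → ℝ) (T : ℝ) (k : ℕ) : Prop :=
  ∃ ε₀ : ℝ, 0 < ε₀ ∧ ∀ ε ∈ Set.Ioo 0 ε₀,
    ∀ x₀ : ℝ → Fin d → ℂ, IsAdmissible A B Λ k x₀ →
    ∀ x₁ : ℝ → Fin d → ℂ, ContDiffOn ℝ k x₁ (Set.Icc 0 ε) →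
    ∃ u : ℝ → Fin m → ℂ, ContDiffOn ℝ k u (Set.Icc 0 (T + ε)) ∧
      ∃ x : ℝ → Fin d → ℂ, IsSolution A B Λ (T + ε) x₀ u x ∧
        ContDiffOn ℝ k x (Set.Icc (-maxDelay Λ) (T + ε)) ∧
        ∀ t ∈ Set.Icc 0 ε, x (T + t) = x₁ t

end DelaySystem

/-! Everything rests on the representation of the zero-state trajectory: with zero initial
condition, x(t) is the sum of `XiHat A c * B` applied to u(t - c.value), over the finitely many
classes c with c.value ≤ t (`response_eq`, `response_mulVec_eq_sum_class`).

Controllability forces the span condition: the formula puts x(T) in the span of the classes with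
c.value ≤ T. A class of value exactly T contributes a multiple of B u(0), and this is 0 because x is
continuous at 0 and vanishes before 0. Hence the strict inequality suffices.

The span condition gives tracking: admissibility is what is needed for some C^k trajectory to
continue x₀ (`IsAdmissible.exists_contDiff_solution`). Subtracting it reduces to tracking an
arbitrary C^k function F from rest. A right inverse of the spanning map splits F(t) among the
classes. For each class a smooth pulse is emitted around time T - c.value, so narrow that near T
each class sees only its own pulse (`exists_separation`, `SpanCondition.exists_tracking_response`).

Tracking a constant gives controllability. -/

section Calculus

/-! ### Extension and gluing of C^k functions of one real variable. -/

variable {E F : Type*} [NormedAddCommGroup E] [NormedSpace ℝ E]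
  [NormedAddCommGroup F] [NormedSpace ℝ F]

/-- A `C^k` function on `ℝ` has a `C^{k+1}` primitive with a prescribed value at one point. -/
theorem ContDiff.exists_primitive [CompleteSpace E] {k : ℕ} {g : ℝ → E} (hg : ContDiff ℝ k g)
    (a : ℝ) (c : E) :
    ∃ f : ℝ → E, ContDiff ℝ (k + 1 : ℕ) f ∧ f a = c ∧ ∀ t, HasDerivAt f (g t) t := by
  have hd : ∀ t, HasDerivAt (fun t => c + ∫ s in a..t, g s) (g t) t := fun t =>
    ((hg.continuous.integral_hasStrictDerivAt a t).hasDerivAt).const_add c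
  refine ⟨_, ?_, by simp, hd⟩
  push_cast
  rw [contDiff_succ_iff_deriv]
  refine ⟨fun t => (hd t).differentiableAt, by simp, ?_⟩
  rwa [show deriv (fun t => c + ∫ s in a..t, g s) = g from funext fun t => (hd t).deriv]

/-- Whitney extension on an interval: a `C^k` function whose `k`-th derivative extends
continuously to `ℝ` extends to a `C^k` function on `ℝ`. -/
theorem ContDiffOn.exists_contDiff_extension [CompleteSpace E] {s : Set ℝ} (hs : Convex ℝ s)
    (hi : (interior s).Nonempty) (k : ℕ) {f : ℝ → E} (hf : ContDiffOn ℝ k f s) {g : ℝ → E}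
    (hg : Continuous g) (hfg : Set.EqOn (iteratedDerivWithin k f s) g s) :
    ∃ h : ℝ → E, ContDiff ℝ k h ∧ Set.EqOn h f s := by
  have hu : UniqueDiffOn ℝ s := uniqueDiffOn_convex hs hi
  induction k generalizing f with
  | zero => exact ⟨g, by simpa [contDiff_zero] using hg, fun t ht => by simpa using (hfg ht).symm⟩
  | succ k ih =>
    push_cast at hf
    obtain ⟨hdf, -, hf'⟩ := (contDiffOn_succ_iff_derivWithin hu).1 hf
    rw [iteratedDerivWithin_succ'] at hfg
    obtain ⟨h', hh', he⟩ := ih hf' hfg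
    obtain ⟨a, ha⟩ := hi.mono interior_subset
    obtain ⟨h, hh, hha, hd⟩ := hh'.exists_primitive a (f a)
    refine ⟨h, hh, fun t ht => ?_⟩
    have hdiff : DifferentiableOn ℝ (fun t => h t - f t) s :=
      (fun t _ => (hd t).differentiableAt.differentiableWithinAt.sub (hdf t ‹_›))
    -- On the convex set `s`, `h - f` has zero derivative and vanishes at `a`.
    have := hs.is_const_of_fderivWithin_eq_zero hdiff (fun y hy => ?_) ha ht
    · rw [hha, sub_self, eq_comm, sub_eq_zero] at this
      exact this
    · have h1 : HasDerivWithinAt (fun t => h t - f t) (h' y - derivWithin f s y) s y :=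
        (hd y).hasDerivWithinAt.sub (hdf y hy).hasDerivWithinAt
      rw [he hy, sub_self] at h1
      have h2 := h1.hasFDerivWithinAt.fderivWithin (hu y hy)
      rw [h2]
      ext
      simp

theorem ContinuousOn.exists_continuous_extension_Icc {X : Type*} [TopologicalSpace X] {a b : ℝ}
    (hab : a ≤ b) {f : ℝ → X} (hf : ContinuousOn f (Set.Icc a b)) :
    ∃ g : ℝ → X, Continuous g ∧ Set.EqOn f g (Set.Icc a b) :=
  ⟨Set.IccExtend hab ((Set.Icc a b).domRestrict f),
    (continuousOn_iff_continuous_domRestrict.1 hf).Icc_extend',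
    fun _ ht => (Set.IccExtend_of_mem hab ((Set.Icc a b).domRestrict f) ht).symm⟩

theorem ContDiffOn.exists_contDiff_extension_Icc [CompleteSpace E] {a b : ℝ} (hab : a < b) {k : ℕ}
    {f : ℝ → E} (hf : ContDiffOn ℝ k f (Set.Icc a b)) :
    ∃ h : ℝ → E, ContDiff ℝ k h ∧ Set.EqOn h f (Set.Icc a b) := by
  have hc := hf.continuousOn_iteratedDerivWithin le_rfl (uniqueDiffOn_Icc hab)
  obtain ⟨g, hg, he⟩ := hc.exists_continuous_extension_Icc hab.le
  exact hf.exists_contDiff_extension (convex_Icc a b) (by simpa using hab) k hg he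

theorem ContDiffOn.exists_contDiff_extension_Ico [CompleteSpace E] {a b : ℝ} (hab : a < b) {k : ℕ}
    {f : ℝ → E} (hf : ContDiffOn ℝ k f (Set.Ico a b)) {l : E}
    (hl : Filter.Tendsto (iteratedDerivWithin k f (Set.Ico a b)) (𝓝[<] b) (𝓝 l)) :
    ∃ h : ℝ → E, ContDiff ℝ k h ∧ Set.EqOn h f (Set.Ico a b) := by
  have hc := hf.continuousOn_iteratedDerivWithin le_rfl (uniqueDiffOn_Ico a b)
  -- Assigning the value `l` at `b` makes the top derivative continuous on the compact interval,
  -- from which it extends to the line.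
  have hc' : ContinuousOn (Function.update (iteratedDerivWithin k f (Set.Ico a b)) b l)
      (Set.Icc a b) := by
    rw [continuousOn_update_iff, Set.Icc_sdiff_right]
    exact ⟨hc, fun _ => hl.mono_left (nhdsWithin_mono _ Set.Ico_subset_Iio_self)⟩
  obtain ⟨g, hg, he⟩ := hc'.exists_continuous_extension_Icc hab.le
  refine hf.exists_contDiff_extension (convex_Ico a b) (by simpa using hab) k hg fun t ht => ?_
  rw [← he (Set.Ico_subset_Icc_self ht), Function.update_of_ne ht.2.ne]

/-- A `C^k` function with vanishing `k`-jet at `0` remains `C^k` when it is replaced by zero on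
the negative half-line. -/
theorem ContDiff.indicator_Ici (k : ℕ) {h : ℝ → E} (hh : ContDiff ℝ k h)
    (h0 : ∀ r ≤ k, iteratedDeriv r h 0 = 0) : ContDiff ℝ k ((Set.Ici 0).indicator h) := by
  induction k generalizing h with
  | zero =>
    have h00 : h 0 = 0 := by simpa using h0 0 le_rfl
    simp only [Nat.cast_zero, contDiff_zero] at hh ⊢
    have : (Set.Ici (0 : ℝ)).indicator h = fun t => if 0 ≤ t then h t else 0 := by
      ext t
      simp [Set.indicator_apply]
    rw [this]
    refine hh.if_le continuous_const continuous_const continuous_id ?_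
    rintro t rfl
    exact h00
  | succ k ih =>
    push_cast at hh ⊢
    obtain ⟨hd, -, hh'⟩ := contDiff_succ_iff_deriv.1 hh
    have h00 : h 0 = 0 := by simpa using h0 0 (Nat.zero_le _)
    have h01 : deriv h 0 = 0 := by simpa using h0 1 (by omega)
    have hder : ∀ t, HasDerivAt ((Set.Ici 0).indicator h) ((Set.Ici 0).indicator (deriv h) t) t := by
      intro t
      rcases lt_trichotomy t 0 with ht | rfl | ht
      · rw [Set.indicator_of_notMem (by simpa using ht)]
        refine (hasDerivAt_const t (0 : E)).congr_of_eventuallyEq ?_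
        filter_upwards [Iio_mem_nhds ht] with s hs
        exact Set.indicator_of_notMem (by simpa using hs) _
      -- At the junction both one-sided derivatives are 0, and they glue to a two-sided one.
      · rw [Set.indicator_of_mem (by simp), h01, ← hasDerivWithinAt_univ, ← Set.Iic_union_Ici (a := 0)]
        refine HasDerivWithinAt.union ?_ ?_
        · refine (hasDerivWithinAt_const 0 _ (0 : E)).congr (fun s hs => ?_) ?_
          · rcases (Set.mem_Iic.1 hs).lt_or_eq with h | rfl
            · exact Set.indicator_of_notMem (by simpa using h) _
            · rw [Set.indicator_of_mem (by simp), h00]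
          · rw [Set.indicator_of_mem (by simp), h00]
        · have := (hd 0).hasDerivAt
          rw [h01] at this
          exact this.hasDerivWithinAt.congr (fun s hs => Set.indicator_of_mem hs _)
            (Set.indicator_of_mem (by simp) _)
      · rw [Set.indicator_of_mem (by simpa using ht.le)]
        refine (hd t).hasDerivAt.congr_of_eventuallyEq ?_
        filter_upwards [Ioi_mem_nhds ht] with s hs
        exact Set.indicator_of_mem (Set.mem_Ici.2 (le_of_lt hs)) _
    refine contDiff_succ_iff_deriv.2 ⟨fun t => (hder t).differentiableAt, by simp, ?_⟩
    rw [show deriv ((Set.Ici 0).indicator h) = (Set.Ici 0).indicator (deriv h) from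
      funext fun t => (hder t).deriv]
    refine ih hh' fun r hr => ?_
    rw [← iteratedDeriv_succ']
    exact h0 (r + 1) (by omega)

/-- Realise the shifted jet by induction, then integrate with initial value `w 0`. -/
theorem exists_contDiff_iteratedDeriv_eq [CompleteSpace E] (k : ℕ) (a : ℝ) (w : ℕ → E) :
    ∃ f : ℝ → E, ContDiff ℝ k f ∧ ∀ r ≤ k, iteratedDeriv r f a = w r := by
  induction k generalizing w with
  | zero =>
    refine ⟨fun _ => w 0, contDiff_const, fun r hr => ?_⟩
    obtain rfl : r = 0 := by omega
    simp
  | succ k ih =>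
    obtain ⟨g, hg, hgw⟩ := ih fun r => w (r + 1)
    obtain ⟨f, hf, hfa, hd⟩ := hg.exists_primitive a (w 0)
    refine ⟨f, hf, fun r hr => ?_⟩
    rcases r with - | r
    · simpa using hfa
    · rw [iteratedDeriv_succ', show deriv f = g from funext fun t => (hd t).deriv]
      exact hgw r (by omega)

theorem ContinuousLinearMap.iteratedDeriv_comp_left (L : E →L[ℝ] F) (r : ℕ) {f : ℝ → E}
    (hf : ContDiff ℝ r f) (t : ℝ) :
    iteratedDeriv r (fun s => L (f s)) t = L (iteratedDeriv r f t) := by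
  induction r generalizing f with
  | zero => simp
  | succ r ih =>
    push_cast at hf
    obtain ⟨hd, -, hf'⟩ := contDiff_succ_iff_deriv.1 hf
    rw [iteratedDeriv_succ', iteratedDeriv_succ', ← ih hf']
    congr 1
    ext s
    exact ((L.hasFDerivAt).comp_hasDerivAt s (hd s).hasDerivAt).deriv

end Calculus

namespace DelaySystem

variable {N d m : ℕ} {A : Fin N → Matrix (Fin d) (Fin d) ℂ} {B : Matrix (Fin d) (Fin m) ℂ}
  {Λ : Fin N → ℝ}

/-! ### Finiteness of the multi-indices and classes below a given time. -/

theorem delayDot_nonneg (hΛ : ∀ j, 0 < Λ j) (n : Fin N → ℕ) : 0 ≤ delayDot Λ n :=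
  Finset.sum_nonneg fun j _ => mul_nonneg (hΛ j).le (Nat.cast_nonneg _)

theorem delayDot_add_single (n : Fin N → ℕ) (j : Fin N) :
    delayDot Λ (n + Pi.single j 1) = delayDot Λ n + Λ j := by
  simp [delayDot, mul_add, Finset.sum_add_distrib, Pi.single_apply]

theorem finite_setOf_delayDot_le (hΛ : ∀ j, 0 < Λ j) (t : ℝ) : {n | delayDot Λ n ≤ t}.Finite := by
  refine (Set.finite_Iic (fun j => ⌊t / Λ j⌋₊)).subset ?_
  intro n hn j
  refine Nat.le_floor ?_
  rw [le_div_iff₀ (hΛ j), mul_comm]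
  exact (Finset.single_le_sum (f := fun j => Λ j * (n j : ℝ))
    (fun i _ => mul_nonneg (hΛ i).le (Nat.cast_nonneg _)) (Finset.mem_univ j)).trans hn

theorem DelayClass.value_delayClass (n : Fin N → ℕ) : (delayClass Λ n).value = delayDot Λ n := rfl

theorem DelayClass.value_injective : Function.Injective (DelayClass.value (Λ := Λ)) :=
  Setoid.kerLift_injective _

theorem DelayClass.exists_rep (c : DelayClass Λ) : ∃ n, delayClass Λ n = c :=
  Quotient.exists_rep c

theorem finite_setOf_value_le (hΛ : ∀ j, 0 < Λ j) (t : ℝ) :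
    {c : DelayClass Λ | c.value ≤ t}.Finite := by
  refine ((finite_setOf_delayDot_le hΛ t).image (delayClass Λ)).subset ?_
  intro c hc
  obtain ⟨n, rfl⟩ := c.exists_rep
  exact ⟨n, hc, rfl⟩

/-! ### The explicit zero-state response. -/

/-- The solution of `x(t) = ∑ j, A_j x(t - Λ_j) + h(t)` that vanishes on the negative half-line,
for a forcing term `h` that vanishes there. -/
noncomputable def response (A : Fin N → Matrix (Fin d) (Fin d) ℂ) (hΛ : ∀ j, 0 < Λ j)
    (h : ℝ → Fin d → ℂ) (t : ℝ) : Fin d → ℂ :=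
  ∑ n ∈ (finite_setOf_delayDot_le hΛ t).toFinset,
    Xi A (fun j => (n j : ℤ)) *ᵥ h (t - delayDot Λ n)

theorem response_of_neg (hΛ : ∀ j, 0 < Λ j) (h : ℝ → Fin d → ℂ) {t : ℝ} (ht : t < 0) :
    response A hΛ h t = 0 := by
  refine Finset.sum_eq_zero fun n hn => absurd (delayDot_nonneg hΛ n) ?_
  simp only [Set.Finite.mem_toFinset, Set.mem_ofPred_eq] at hn
  linarith

/-- Makes the index set independent of `t` on a half-line, so that regularity can be read off a
fixed finite sum. -/
theorem response_eq_sum_of_le (hΛ : ∀ j, 0 < Λ j) {h : ℝ → Fin d → ℂ} (hh : ∀ t < 0, h t = 0)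
    {t M : ℝ} (htM : t ≤ M) :
    response A hΛ h t = ∑ n ∈ (finite_setOf_delayDot_le hΛ M).toFinset,
      Xi A (fun j => (n j : ℤ)) *ᵥ h (t - delayDot Λ n) := by
  refine Finset.sum_subset (fun n hn => ?_) fun n _ hn => ?_
  · simp only [Set.Finite.mem_toFinset, Set.mem_ofPred_eq] at hn ⊢
    exact hn.trans htM
  · simp only [Set.Finite.mem_toFinset, Set.mem_ofPred_eq, not_le] at hn
    rw [hh _ (by linarith), Matrix.mulVec_zero]

/-- The recursion for `Xi`, summed against the shifted forcing term. The index 0 produces `h t`;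
every other index produces the delayed terms. -/
theorem response_eq (hΛ : ∀ j, 0 < Λ j) (h : ℝ → Fin d → ℂ) {t : ℝ} (ht : 0 ≤ t) :
    response A hΛ h t = ∑ j, A j *ᵥ response A hΛ h (t - Λ j) + h t := by
  have h0 : (0 : Fin N → ℕ) ∈ (finite_setOf_delayDot_le hΛ t).toFinset := by
    simpa [delayDot] using ht
  have hstep : ∀ n : Fin N → ℕ, n ≠ 0 → Xi A (fun j => (n j : ℤ)) =
      ∑ k, A k * Xi A ((fun j => (n j : ℤ)) - Pi.single k 1) := fun n hn =>
    Xi_rec A (fun i => Int.natCast_nonneg _) fun hz => hn <| funext fun i => by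
      simpa using congrFun hz i
  have hshift : ∀ k, A k *ᵥ response A hΛ h (t - Λ k) =
      ∑ n ∈ (finite_setOf_delayDot_le hΛ t).toFinset,
        (A k * Xi A ((fun j => (n j : ℤ)) - Pi.single k 1)) *ᵥ h (t - delayDot Λ n) := by
    intro k
    rw [response, Matrix.mulVec_sum]
    -- Reindex by n ↦ n + e_k, which raises Λ·n by exactly Λ_k.
    refine Finset.sum_of_injOn (fun n => n + Pi.single k 1) (add_left_injective _).injOn ?_ ?_ ?_
    · intro n hn
      simp only [Set.Finite.coe_toFinset, Set.mem_ofPred_eq, delayDot_add_single] at hn ⊢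
      linarith
    -- Indices missed by the shift have n_k = 0, so n - e_k leaves ℕ^N and `Xi` vanishes there.
    · intro n hn hn'
      rw [Xi_of_neg, Matrix.mul_zero, Matrix.zero_mulVec]
      intro hpos
      have hk : 1 ≤ n k := by simpa using hpos k
      have hadd : n - Pi.single k 1 + Pi.single k 1 = n :=
        tsub_add_cancel_of_le fun i => by
          by_cases hik : i = k
          · subst hik
            simpa using hk
          · simp [hik]
      refine hn' ⟨n - Pi.single k 1, ?_, hadd⟩
      have := delayDot_add_single (Λ := Λ) (n - Pi.single k 1) k
      rw [hadd] at this
      simp only [Set.Finite.mem_toFinset, Set.Finite.coe_toFinset, Set.mem_ofPred_eq] at hn ⊢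
      linarith
    · intro n _
      rw [delayDot_add_single, Matrix.mulVec_mulVec]
      congr 2
      · congr 2
        ext j
        by_cases hjk : j = k
        · subst hjk
          simp
        · simp [hjk]
      · ring
  simp only [hshift]
  rw [Finset.sum_comm, response, ← Finset.add_sum_erase _ _ h0, ← Finset.add_sum_erase _ _ h0,
    add_comm, add_assoc]
  have hz : Xi A (fun j => (((0 : Fin N → ℕ) j : ℕ) : ℤ)) = 1 := by
    exact Xi_zero A
  have hz' : ∀ k, Xi A ((fun j => (((0 : Fin N → ℕ) j : ℕ) : ℤ)) - Pi.single k 1) = 0 :=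
    fun k => Xi_of_neg A fun hpos => by simpa using hpos k
  simp only [hz, hz', Matrix.mul_zero, Matrix.zero_mulVec, Finset.sum_const_zero, zero_add,
    Matrix.one_mulVec]
  congr 1
  · refine Finset.sum_congr rfl fun n hn => ?_
    rw [hstep n (Finset.ne_of_mem_erase hn), Matrix.sum_mulVec]
  · simp [delayDot]

theorem response_mulVec_eq_sum_class (hΛ : ∀ j, 0 < Λ j) (v : ℝ → Fin m → ℂ) (t : ℝ) :
    response A hΛ (fun s => B *ᵥ v s) t =
      ∑ c ∈ (finite_setOf_value_le hΛ t).toFinset, (XiHat A c * B) *ᵥ v (t - c.value) := by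
  classical
  rw [response, ← Finset.sum_fiberwise_of_maps_to (g := delayClass Λ)
    (t := (finite_setOf_value_le hΛ t).toFinset)]
  · refine Finset.sum_congr rfl fun c hc => ?_
    rw [XiHat, show (∑ᶠ (n : Fin N → ℕ) (_ : delayClass Λ n = c), Xi A (fun j => (n j : ℤ))) =
      ∑ n ∈ (finite_class hΛ c).toFinset, Xi A (fun j => (n j : ℤ)) from
      finsum_mem_eq_finite_toFinset_sum _ (finite_class hΛ c), Matrix.sum_mul, Matrix.sum_mulVec]
    simp only [Set.Finite.mem_toFinset, Set.mem_ofPred_eq] at hc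
    refine Finset.sum_congr ?_ fun n hn => ?_
    · ext n
      simp only [Finset.mem_filter, Set.Finite.mem_toFinset, Set.mem_ofPred_eq,
        and_iff_right_iff_imp]
      rintro rfl
      exact hc
    · simp only [Set.Finite.mem_toFinset, Set.mem_ofPred_eq] at hn
      rw [← hn, DelayClass.value_delayClass, Matrix.mulVec_mulVec]
  · intro n hn
    simpa [DelayClass.value_delayClass] using hn

/-- Left multiplication of vectors by a complex matrix, as a real continuous linear map. -/
noncomputable def mulVecRealCLM {p q : ℕ} (M : Matrix (Fin p) (Fin q) ℂ) :
    (Fin q → ℂ) →L[ℝ] (Fin p → ℂ) :=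
  M.mulVecLin.toContinuousLinearMap.restrictScalars ℝ

theorem mulVecRealCLM_apply {p q : ℕ} (M : Matrix (Fin p) (Fin q) ℂ) (x : Fin q → ℂ) :
    mulVecRealCLM M x = M *ᵥ x := rfl

theorem _root_.ContDiff.mulVec_const {p q k : ℕ} (M : Matrix (Fin p) (Fin q) ℂ)
    {f : ℝ → Fin q → ℂ} (hf : ContDiff ℝ k f) : ContDiff ℝ k fun t => M *ᵥ f t :=
  (mulVecRealCLM M).contDiff.comp hf

theorem response_contDiff (hΛ : ∀ j, 0 < Λ j) {k : ℕ} {h : ℝ → Fin d → ℂ}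
    (hh : ∀ t < 0, h t = 0) (hk : ContDiff ℝ k h) : ContDiff ℝ k (response A hΛ h) := by
  refine contDiff_iff_contDiffAt.2 fun t => ?_
  have hs : ContDiff ℝ k fun s => ∑ n ∈ (finite_setOf_delayDot_le hΛ (t + 1)).toFinset,
      Xi A (fun j => (n j : ℤ)) *ᵥ h (s - delayDot Λ n) :=
    ContDiff.sum fun n _ => ContDiff.mulVec_const _ (hk.comp (contDiff_id.sub contDiff_const))
  refine hs.contDiffAt.congr_of_eventuallyEq ?_
  filter_upwards [Iio_mem_nhds (lt_add_one t)] with s hs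
  exact response_eq_sum_of_le hΛ hh (le_of_lt hs)

/-! ### Continuing an admissible initial condition. -/

theorem le_maxDelay (Λ : Fin N → ℝ) (j : Fin N) : Λ j ≤ maxDelay Λ :=
  le_ciSup (Set.finite_range Λ).bddAbove j

theorem maxDelay_pos (hN : 0 < N) (hΛ : ∀ j, 0 < Λ j) : 0 < maxDelay Λ :=
  (hΛ ⟨0, hN⟩).trans_le (le_maxDelay Λ _)

/-- An admissible initial condition extends to a `C^k` function on `ℝ` that solves the system on
`[0, ∞)` for some `C^k` control. -/
theorem IsAdmissible.exists_contDiff_solution (hN : 0 < N) (hΛ : ∀ j, 0 < Λ j) {k : ℕ}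
    {x₀ : ℝ → Fin d → ℂ} (hx₀ : IsAdmissible A B Λ k x₀) :
    ∃ (u : ℝ → Fin m → ℂ) (y : ℝ → Fin d → ℂ), ContDiff ℝ k u ∧ ContDiff ℝ k y ∧
      Set.EqOn y x₀ (Set.Ico (-maxDelay Λ) 0) ∧
      ∀ t, 0 ≤ t → y t = ∑ j, A j *ᵥ y (t - Λ j) + B *ᵥ u t := by
  have hmax : -maxDelay Λ < 0 := neg_lt_zero.2 (maxDelay_pos hN hΛ)
  obtain ⟨_, hl, -⟩ := hx₀.compat k le_rfl
  obtain ⟨X, hX, hXe⟩ := hx₀.contDiffOn.exists_contDiff_extension_Ico hmax hl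
  have hderiv : ∀ r ≤ k, ∀ t ∈ Set.Ico (-maxDelay Λ) 0,
      iteratedDerivWithin r x₀ (Set.Ico (-maxDelay Λ) 0) t = iteratedDeriv r X t := by
    intro r hr t ht
    rw [← iteratedDerivWithin_congr hXe ht]
    exact iteratedDerivWithin_eq_iteratedDeriv (uniqueDiffOn_Ico _ _)
      (hX.contDiffAt.of_le (by exact_mod_cast hr)) ht
  -- Defect of the extension `X` in the uncontrolled equation; admissibility says that its k-jet at
  -- 0 lies in the range of `B`.
  let g : ℝ → Fin d → ℂ := fun t => X t - ∑ j, A j *ᵥ X (t - Λ j)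
  have hXA : ∀ j, ContDiff ℝ k fun t => A j *ᵥ X (t - Λ j) := fun j =>
    ContDiff.mulVec_const _ (hX.comp (contDiff_id.sub contDiff_const))
  have hg : ContDiff ℝ k g := hX.sub (ContDiff.sum fun j _ => hXA j)
  have hgr : ∀ r ≤ k, iteratedDeriv r g 0 =
      iteratedDeriv r X 0 - ∑ j, A j *ᵥ iteratedDeriv r X (-Λ j) := by
    intro r hr
    have hrk : (r : WithTop ℕ∞) ≤ k := by exact_mod_cast hr
    rw [iteratedDeriv_fun_sub (hX.of_le hrk).contDiffAt
      (ContDiff.sum fun j _ => (hXA j).of_le hrk).contDiffAt,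
      iteratedDeriv_fun_sum fun j _ => ((hXA j).of_le hrk).contDiffAt]
    congr 1
    refine Finset.sum_congr rfl fun j _ => ?_
    rw [← mulVecRealCLM_apply, ← zero_sub (Λ j),
      ← congrFun (iteratedDeriv_comp_sub_const r X (Λ j)) 0]
    exact (mulVecRealCLM (A j)).iteratedDeriv_comp_left r
      ((hX.comp (contDiff_id.sub contDiff_const)).of_le hrk) 0
  have hran : ∀ r, ∃ w : Fin m → ℂ, r ≤ k → B *ᵥ w = iteratedDeriv r g 0 := by
    intro r
    by_cases hr : r ≤ k
    · obtain ⟨l, hl, w, hw⟩ := hx₀.compat r hr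
      have hlX : l = iteratedDeriv r X 0 := by
        have : (𝓝[<] (0 : ℝ)).NeBot := inferInstance
        refine tendsto_nhds_unique hl ?_
        have hc := hX.continuous_iteratedDeriv r (by exact_mod_cast hr)
        refine ((hc.tendsto 0).mono_left nhdsWithin_le_nhds).congr' ?_
        filter_upwards [Ico_mem_nhdsLT hmax] with t ht
        exact (hderiv r hr t ht).symm
      refine ⟨w, fun _ => ?_⟩
      rw [hgr r hr, ← hlX]
      refine (Matrix.mulVecLin_apply B w).symm.trans (hw.trans ?_)
      congr 1
      refine Finset.sum_congr rfl fun j _ => ?_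
      rw [hderiv r hr _ ⟨neg_le_neg (le_maxDelay Λ j), neg_lt_zero.2 (hΛ j)⟩]
    · exact ⟨0, fun h => absurd h hr⟩
  choose w hw using hran
  obtain ⟨u, hu, huw⟩ := exists_contDiff_iteratedDeriv_eq k 0 w
  -- `u` is chosen so that `B u` and `g` have the same k-jet at 0. The remaining mismatch can thus
  -- be cut off at 0 without losing regularity, and the response to it corrects `X`.
  let h : ℝ → Fin d → ℂ := (Set.Ici 0).indicator fun t => B *ᵥ u t - g t
  have hBu : ContDiff ℝ k fun t => B *ᵥ u t := hu.mulVec_const B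
  have hh : ContDiff ℝ k h := by
    refine ContDiff.indicator_Ici k (hBu.sub hg) fun r hr => ?_
    have hrk : (r : WithTop ℕ∞) ≤ k := by exact_mod_cast hr
    rw [iteratedDeriv_fun_sub (hBu.of_le hrk).contDiffAt (hg.of_le hrk).contDiffAt, ← hw r hr,
      ← huw r hr, sub_eq_zero]
    exact (mulVecRealCLM B).iteratedDeriv_comp_left r (hu.of_le hrk) 0
  have hneg : ∀ t < 0, h t = 0 := fun t ht => Set.indicator_of_notMem (by simpa using ht) _
  refine ⟨u, fun t => X t + response A hΛ h t, hu, hX.add (response_contDiff hΛ hneg hh),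
    fun t ht => ?_, fun t ht => ?_⟩
  · simp only [response_of_neg hΛ h ht.2, add_zero]
    exact hXe ht
  · simp only [response_eq hΛ h ht, Matrix.mulVec_add, Finset.sum_add_distrib]
    rw [show h t = B *ᵥ u t - g t from Set.indicator_of_mem (Set.mem_Ici.2 ht) _]
    simp only [g]
    abel

/-! ### From the span condition to tracking. -/

theorem SpanCondition.exists_rightInverse (hΛ : ∀ j, 0 < Λ j) {T : ℝ}
    (h : SpanCondition A B Λ T) :
    ∃ (C : Finset (DelayClass Λ)) (R : DelayClass Λ → Matrix (Fin m) (Fin d) ℂ),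
      (∀ c ∈ C, c.value < T) ∧
      ∀ x : Fin d → ℂ, ∑ c ∈ C, (XiHat A c * B) *ᵥ (R c *ᵥ x) = x := by
  classical
  have hfin : {c : DelayClass Λ | c.value < T}.Finite :=
    (finite_setOf_value_le hΛ T).subset fun c (hc : c.value < T) => hc.le
  let L : (DelayClass Λ → Fin m → ℂ) →ₗ[ℂ] (Fin d → ℂ) :=
    ∑ c ∈ hfin.toFinset, (XiHat A c * B).mulVecLin ∘ₗ LinearMap.proj c
  have hL : ∀ w, L w = ∑ c ∈ hfin.toFinset, (XiHat A c * B) *ᵥ w c := fun w => by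
    simp [L, LinearMap.sum_apply]
  have hrange : LinearMap.range L = ⊤ := by
    rw [eq_top_iff, ← h, Submodule.span_le]
    rintro _ ⟨c, w, hc, rfl⟩
    refine ⟨Pi.single c w, ?_⟩
    rw [hL, Finset.sum_eq_single c]
    · rw [Pi.single_eq_same]
    · intro b _ hb
      rw [Pi.single_eq_of_ne hb, Matrix.mulVec_zero]
    · intro hc'
      exact absurd (by simpa using hc) hc'
  obtain ⟨R, hR⟩ := L.exists_rightInverse_of_surjective hrange
  refine ⟨hfin.toFinset, fun c => LinearMap.toMatrix' (LinearMap.proj c ∘ₗ R),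
    fun c hc => by simpa using hc, fun x => ?_⟩
  have := LinearMap.congr_fun hR x
  simp only [LinearMap.comp_apply, hL, LinearMap.id_apply] at this
  simpa [LinearMap.toMatrix'_mulVec] using this

/-- Distinct classes have distinct values and only finitely many values are at most T + 1, so the
gaps have a positive lower bound. Classes outside `C`, with value up to T + 1, must be separated as
well, since they too pick up the control just after T. -/
theorem exists_separation (hΛ : ∀ j, 0 < Λ j) (T : ℝ) (C : Finset (DelayClass Λ))
    (hC : ∀ c ∈ C, c.value < T) :
    ∃ η : ℝ, 0 < η ∧ η ≤ 1 ∧ ∀ c ∈ C, 2 * η ≤ T - c.value ∧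
      ∀ c' : DelayClass Λ, c'.value ≤ T + 1 → c' ≠ c → 2 * η ≤ |c.value - c'.value| := by
  have hsmall : ∀ a : ℝ, 0 < a → ∀ᶠ η in 𝓝[>] (0 : ℝ), 2 * η ≤ a := fun a ha => by
    filter_upwards [Ioc_mem_nhdsGT (half_pos ha)] with η hη
    linarith [hη.2]
  have h2 : ∀ c ∈ C, ∀ᶠ η in 𝓝[>] (0 : ℝ), 2 * η ≤ T - c.value ∧
      ∀ c' : DelayClass Λ, c'.value ≤ T + 1 → c' ≠ c → 2 * η ≤ |c.value - c'.value| := by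
    intro c hc
    refine (hsmall _ (sub_pos.2 (hC c hc))).and ?_
    refine (Filter.eventually_all_finite (finite_setOf_value_le hΛ (T + 1))).2 fun c' _ => ?_
    by_cases hcc : c' = c
    · exact Filter.Eventually.of_forall fun η hn => absurd hcc hn
    · filter_upwards [hsmall _ (abs_pos.2 (sub_ne_zero.2 fun he =>
        hcc (DelayClass.value_injective he).symm))] with η hη _
      exact hη
  obtain ⟨η, h, hη, hη1⟩ := (((Filter.eventually_all_finset C).2 h2).and
    (Ioc_mem_nhdsGT (zero_lt_one' ℝ))).exists
  exact ⟨η, hη, hη1, h⟩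

/-- Under the span condition, every `C^k` function can be tracked on a short interval after `T`,
starting from rest. -/
theorem SpanCondition.exists_tracking_response (hΛ : ∀ j, 0 < Λ j) {T : ℝ}
    (h : SpanCondition A B Λ T) (k : ℕ) :
    ∃ ε₀ : ℝ, 0 < ε₀ ∧ ∀ F : ℝ → Fin d → ℂ, ContDiff ℝ k F →
      ∃ v : ℝ → Fin m → ℂ, ContDiff ℝ k v ∧ (∀ t < 0, v t = 0) ∧
        ∀ t ∈ Set.Ico 0 ε₀, response A hΛ (fun s => B *ᵥ v s) (T + t) = F t := by
  classical
  obtain ⟨C, R, hC, hR⟩ := h.exists_rightInverse hΛ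
  obtain ⟨η, hη, hη1, hsep⟩ := exists_separation hΛ T C hC
  refine ⟨η / 2, half_pos hη, fun F hF => ?_⟩
  let χ : ContDiffBump (0 : ℝ) := ⟨η / 2, η, half_pos hη, half_lt_self hη⟩
  have hχ1 : ∀ s : ℝ, |s| ≤ η / 2 → χ s = 1 := fun s hs =>
    χ.one_of_mem_closedBall (by simpa using hs)
  have hχ0 : ∀ s : ℝ, η ≤ |s| → χ s = 0 := fun s hs =>
    χ.zero_of_le_dist (by simpa using hs)
  have hχ : ContDiff ℝ k χ := χ.contDiff
  -- The pulse for `c` is centred at T - c.value, so that through the class `c` it arrives at time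
  -- T.
  let v : ℝ → Fin m → ℂ := fun s =>
    ∑ c ∈ C, χ (s - (T - c.value)) • (R c *ᵥ F (s - (T - c.value)))
  refine ⟨v, ?_, fun t ht => ?_, fun t ht => ?_⟩
  · refine ContDiff.sum fun c _ => ?_
    have hsub : ContDiff ℝ k fun s : ℝ => s - (T - c.value) := contDiff_id.sub contDiff_const
    exact (hχ.comp hsub).smul ((hF.comp hsub).mulVec_const (R c))
  · refine Finset.sum_eq_zero fun c hc => ?_
    rw [hχ0, zero_smul]
    have := (hsep c hc).1
    rw [abs_of_neg (by linarith)]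
    linarith
  · have hCsub : C ⊆ (finite_setOf_value_le hΛ (T + t)).toFinset := fun c hc => by
      simp only [Set.Finite.mem_toFinset, Set.mem_ofPred_eq]
      linarith [hC c hc, ht.1]
    have habs : |t| ≤ η / 2 := by
      rw [abs_of_nonneg ht.1]
      exact ht.2.le
    have hval : ∀ c' : DelayClass Λ, c'.value ≤ T + t → ∀ c ∈ C, c' ≠ c →
        χ (T + t - c'.value - (T - c.value)) = 0 := by
      intro c' hc' c hc hne
      refine hχ0 _ ?_
      have h1 := (hsep c hc).2 c' (by linarith [ht.2]) hne
      -- A gap of at least 2η, shifted by |t| ≤ η/2, still exceeds the pulse radius η.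
      have h2 := abs_sub_abs_le_abs_sub (c.value - c'.value) (-t)
      rw [abs_neg] at h2
      rw [show T + t - c'.value - (T - c.value) = c.value - c'.value - -t by ring]
      linarith
    rw [response_mulVec_eq_sum_class hΛ, ← hR (F t)]
    symm
    -- Classes outside `C` meet no pulse; a class in `C` meets only its own, on the plateau where
    -- `χ` is 1.
    refine Finset.sum_subset_zero_on_sdiff hCsub (fun c' hc' => ?_) fun c hc => ?_
    · simp only [Finset.mem_sdiff, Set.Finite.mem_toFinset, Set.mem_ofPred_eq] at hc'
      rw [show v (T + t - c'.value) = 0 from Finset.sum_eq_zero fun c hc => by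
        rw [hval c' hc'.1 c hc fun he => hc'.2 (he ▸ hc), zero_smul], Matrix.mulVec_zero]
    · have hle : c.value ≤ T + t := by linarith [hC c hc, ht.1]
      rw [show v (T + t - c.value) = R c *ᵥ F t from ?_]
      simp only [v]
      rw [Finset.sum_eq_single_of_mem c hc fun b hb hbc => by
        rw [hval c hle b hb hbc.symm, zero_smul]]
      rw [show T + t - c.value - (T - c.value) = t by ring, hχ1 t habs, one_smul]

theorem SpanCondition.ckTrackable (hN : 0 < N) (hΛ : ∀ j, 0 < Λ j) {T : ℝ}
    (h : SpanCondition A B Λ T) (k : ℕ) : CkTrackable A B Λ T k := by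
  obtain ⟨ε₀, hε₀, htrack⟩ := h.exists_tracking_response hΛ k
  refine ⟨ε₀, hε₀, fun ε hε x₀ hx₀ x₁ hx₁ => ?_⟩
  obtain ⟨u, y, hu, hy, hyx, hsol⟩ := hx₀.exists_contDiff_solution hN hΛ
  obtain ⟨X₁, hX₁, hX₁e⟩ := hx₁.exists_contDiff_extension_Icc hε.1
  -- By linearity, only the error between the target and the reference trajectory `y` has to be
  -- tracked from rest.
  obtain ⟨v, hv, hv0, hvF⟩ := htrack (fun t => X₁ t - y (T + t))
    (hX₁.sub (hy.comp (contDiff_const.add contDiff_id)))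
  refine ⟨fun t => u t + v t, (hu.add hv).contDiffOn,
    fun t => y t + response A hΛ (fun s => B *ᵥ v s) t, ⟨fun t ht => ?_, fun t ht => ?_⟩,
    (hy.add (response_contDiff hΛ (fun t ht => ?_) (hv.mulVec_const B))).contDiffOn,
    fun t ht => ?_⟩
  · simp only [hsol t ht.1, response_eq hΛ _ ht.1, Matrix.mulVec_add, Finset.sum_add_distrib]
    abel
  · simp only [response_of_neg hΛ _ ht.2, add_zero]
    exact hyx ht
  · rw [hv0 t ht, Matrix.mulVec_zero]
  · simp only [hvF t ⟨ht.1, ht.2.trans_lt hε.2⟩, ← hX₁e ht]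
    abel

/-! ### From tracking to controllability, and back to the span condition. -/

theorem IsSolution.mono {S T : ℝ} (hST : S ≤ T) {x₀ x : ℝ → Fin d → ℂ} {u : ℝ → Fin m → ℂ}
    (h : IsSolution A B Λ T x₀ u x) : IsSolution A B Λ S x₀ u x :=
  ⟨fun t ht => h.eqn t ⟨ht.1, ht.2.trans hST⟩, h.init⟩

theorem CkTrackable.ckControllable {T : ℝ} {k : ℕ} (h : CkTrackable A B Λ T k) :
    CkControllable A B Λ T k := by
  obtain ⟨ε₀, hε₀, h⟩ := h
  intro x₀ hx₀ x₁
  have hle : T ≤ T + ε₀ / 2 := by linarith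
  obtain ⟨u, hu, x, hx, hxk, hx₁⟩ :=
    h (ε₀ / 2) ⟨half_pos hε₀, half_lt_self hε₀⟩ x₀ hx₀ (fun _ => x₁) contDiffOn_const
  refine ⟨u, hu.mono (Set.Icc_subset_Icc_right hle), x, hx.mono hle,
    hxk.mono (Set.Icc_subset_Icc_right hle), ?_⟩
  simpa using hx₁ 0 ⟨le_rfl, (half_pos hε₀).le⟩

theorem isAdmissible_zero (A : Fin N → Matrix (Fin d) (Fin d) ℂ) (B : Matrix (Fin d) (Fin m) ℂ)
    (Λ : Fin N → ℝ) (k : ℕ) : IsAdmissible A B Λ k fun _ => 0 := by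
  have h0 : ∀ r, iteratedDerivWithin r (fun _ : ℝ => (0 : Fin d → ℂ))
      (Set.Ico (-maxDelay Λ) 0) = fun _ => 0 := fun r => by
    ext t : 1
    simp
  refine ⟨contDiffOn_const, fun r _ => ⟨0, ?_, ?_⟩⟩
  · rw [h0]
    exact tendsto_const_nhds
  · simp

/-- The value at time `T` of a solution with zero initial condition and control `u`. -/
theorem IsSolution.eq_sum_class (hN : 0 < N) (hΛ : ∀ j, 0 < Λ j) {T : ℝ} (hT : 0 ≤ T)
    {x : ℝ → Fin d → ℂ} {u : ℝ → Fin m → ℂ} (hx : IsSolution A B Λ T (fun _ => 0) u x) :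
    x T = ∑ c ∈ (finite_setOf_value_le hΛ T).toFinset, (XiHat A c * B) *ᵥ u (T - c.value) := by
  have hz : IsSolution A B Λ T (fun _ => 0) u (response A hΛ fun s => B *ᵥ u s) :=
    ⟨fun t ht => response_eq hΛ _ ht.1, fun t ht => response_of_neg hΛ _ ht.2⟩
  rw [hx.eqOn hΛ hz ⟨by linarith [maxDelay_pos hN hΛ], le_rfl⟩, response_mulVec_eq_sum_class]

theorem CkControllable.spanCondition (hN : 0 < N) (hΛ : ∀ j, 0 < Λ j) {T : ℝ} (hT : 0 < T)
    {k : ℕ} (h : CkControllable A B Λ T k) : SpanCondition A B Λ T := by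
  have hmax := maxDelay_pos hN hΛ
  refine eq_top_iff.2 fun x₁ _ => ?_
  obtain ⟨u, -, x, hx, hxk, rfl⟩ := h _ (isAdmissible_zero A B Λ k) x₁
  -- The required continuity of `x` across 0 is used here: it constrains `u 0`.
  have hx0 : x 0 = 0 := by
    have hc := (hxk.continuousOn 0 ⟨by linarith, hT.le⟩).mono_left
      (nhdsWithin_mono 0 (Set.Ico_subset_Ico_right hT.le |>.trans Set.Ico_subset_Icc_self))
    rw [nhdsWithin_Ico_eq_nhdsLT (by linarith)] at hc
    refine tendsto_nhds_unique hc (tendsto_const_nhds.congr' ?_)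
    filter_upwards [Ico_mem_nhdsLT (show -maxDelay Λ < 0 by linarith)] with t ht
    exact (hx.init t ht).symm
  have hBu : B *ᵥ u 0 = 0 := by
    have := hx.eqn 0 ⟨le_rfl, hT.le⟩
    rw [hx0, Finset.sum_eq_zero, zero_add] at this
    · exact this.symm
    · intro j _
      rw [hx.init _ ⟨by linarith [le_maxDelay Λ j], by linarith [hΛ j]⟩, Matrix.mulVec_zero]
  rw [hx.eq_sum_class hN hΛ hT.le]
  refine Submodule.sum_mem _ fun c hc => ?_
  simp only [Set.Finite.mem_toFinset, Set.mem_ofPred_eq] at hc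
  rcases hc.lt_or_eq with hlt | heq
  · exact Submodule.subset_span ⟨c, _, hlt, rfl⟩
  -- A class of value exactly T sees the control at time 0, where `B` annihilates it.
  · rw [heq, sub_self, ← Matrix.mulVec_mulVec, hBu, Matrix.mulVec_zero]
    exact Submodule.zero_mem _

end DelaySystem

theorem theorem3p2 {N d m : ℕ} (hN : 0 < N)
    (A : Fin N → Matrix (Fin d) (Fin d) ℂ) (B : Matrix (Fin d) (Fin m) ℂ)
    (Λ : Fin N → ℝ) (hΛ : ∀ j, 0 < Λ j) (T : ℝ) (hT : 0 < T) (k : ℕ) :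
    List.TFAE [
      DelaySystem.SpanCondition A B Λ T,
      DelaySystem.CkControllable A B Λ T k,
      DelaySystem.CkTrackable A B Λ T k] := by
  tfae_have 1 → 3 := fun h => h.ckTrackable hN hΛ k
  tfae_have 3 → 2 := fun h => h.ckControllable
  tfae_have 2 → 1 := fun h => h.spanCondition hN hΛ hT
  tfae_finish
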